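/- **Setting.** A user plays a media file of infinite size at unit rate and receives packets from a free server and a costly server. Let $R_0>1$, $R_c>0$ and $R_1=R_0+R_c$. On a filtered probability space, let $N$ and $N^c$ be independent Poisson processes, relative to the given filtration, of rates $R_0$ and $R_c$. Under a stationary policy $\pi:\mathbb R\to\{0,1\}$ the buffer size with initial value $D$ is an adapted process with $$x_t = D + N_t + \int_0^t u_s\,dN^c_s - t ,\qquad t\ge 0,$$ where $u_s=\pi(x_{s-})$ is the action in force just before time $s$ ($0$: free server only, $1$: both servers). Let $\tau_e=\inf\{t: x_t\le 0\}$ (with $\inf\emptyset=\infty$). Since the file is infinite, the interruption probability is $p^{\pi}(D)=\Pr(\tau_e<\infty)$, and $\pi$ is *$(D,\epsilon)$-feasible* if $p^{\pi}(D)\le\epsilon$. For $T\in\mathbb R$, the *risky policy* $\pi^T$ is $\pi^T(x)=1$ if $0<x<T$ and $\pi^T(x)=0$ otherwise. For $R>1$ let $\bar r(R)=\sup\{r\in\mathbb R: r+R(e^{-r}-1)=0\}$, and put $$\alpha_0=\bar r(R_0),\qquad \alpha_1=\bar r(R_1),\qquad \beta=\frac{\alpha_1}{\alpha_0(1-\alpha_0/2)},\qquad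 \bar D=\frac1{\alpha_1}\log\frac{\beta}{\epsilon}.$$ Assume $\alpha_0<2$, so that $\beta$ is defined and positive. Let $$\mathcal R=\Big\{(D,\epsilon):\epsilon>0,\ \tfrac1{\alpha_1}\log\tfrac1\epsilon\le D\le\tfrac1{\alpha_0}\log\tfrac1\epsilon\Big\}.$$ **Theorem.** Let $(D,\epsilon)\in\mathcal R$ and $$T^*=\begin{cases}\dfrac{1}{\alpha_1-\alpha_0}\Big[\log\dfrac{\beta}{\epsilon}-\alpha_0 D\Big], & D\ge\bar D,\\[2ex] \dfrac1{\alpha_1}\log\left(\dfrac{\epsilon+\beta(1-e^{-\alpha_1 D})-1}{\epsilon-e^{-\alpha_1 D}}\right), & D\le\bar D,\end{cases}$$ where $T^*=+\infty$ if $\epsilon=e^{-\alpha_1 D}$ (the two cases agree at $D=\bar D$). Then for every real $T\ge T^*$ the risky policy $\pi^T$ is $(D,\epsilon)$-feasible, i.e. $p^{\pi^T}(D)\le\epsilon$. -/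

import Mathlib

open MeasureTheory ProbabilityTheory
open scoped NNReal ENNReal

noncomputable section

namespace Streaming

/-- `r̄(R) = sup {r : γ(r) = 0}`, where `γ(r) = r + R (e^{-r} - 1)`. For `R > 1` the set is
finite and nonempty, and `r̄(R) > 0`. -/
def rBar (R : ℝ) : ℝ :=
  sSup {r : ℝ | r + R * (Real.exp (-r) - 1) = 0}

/-- The region `𝓡` of the pairs `(D, ε)` with
`(1/α₁) log (1/ε) ≤ D ≤ (1/α₀) log (1/ε)`. -/
def region (α₀ α₁ : ℝ) : Set (ℝ × ℝ) :=
  {p | 1 / α₁ * Real.log (1 / p.2) ≤ p.1 ∧ p.1 ≤ 1 / α₀ * Real.log (1 / p.2)}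

/-- `β = α₁ / (α₀ (1 - α₀ / 2))`. -/
def betaConst (α₀ α₁ : ℝ) : ℝ :=
  α₁ / (α₀ * (1 - α₀ / 2))

/-- `D̄ = (1/α₁) log (β/ε)`. -/
def DBar (α₀ α₁ ε : ℝ) : ℝ :=
  1 / α₁ * Real.log (betaConst α₀ α₁ / ε)

open Classical in
/-- The threshold `T*` as an extended real. In the second case, the denominator
`ε - e^{-α₁ D}` vanishes exactly when `D = (1/α₁) log (1/ε)` (the lower boundary of the region);
there the quotient is to be read as `+∞`, and so `T* = +∞`. -/
def thresholdStar (α₀ α₁ D ε : ℝ) : EReal :=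
  if DBar α₀ α₁ ε ≤ D then
    ((1 / (α₁ - α₀) * (Real.log (betaConst α₀ α₁ / ε) - α₀ * D) : ℝ) : EReal)
  else if ε - Real.exp (-(α₁ * D)) = 0 then ⊤
  else
    ((1 / α₁ * Real.log ((ε + betaConst α₀ α₁ * (1 - Real.exp (-(α₁ * D))) - 1)
      / (ε - Real.exp (-(α₁ * D)))) : ℝ) : EReal)

/-- A stationary Markov association policy: the action depends only on the current buffer size.
Action `0` uses the free server only, action `1` uses both servers. -/
abbrev MarkovPolicy : Type := ℝ → Fin 2

open Classical in
/-- The risky policy `π^T`: use the costly server iff `0 < x < T`. -/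
def riskyPolicy (T : ℝ) : MarkovPolicy :=
  fun x => if 0 < x ∧ x < T then 1 else 0

section Model

variable {Ω : Type*} {mΩ : MeasurableSpace Ω}

/-- `N` and `Nc` are independent Poisson processes with rates `R₀` and `Rc` with respect to the
filtration `ℱ`: adapted counting processes (paths nondecreasing, right-continuous, started at `0`,
almost surely) such that over every time interval `(s, t]` the two increments are Poisson with
means `R₀ (t - s)` and `Rc (t - s)`, independent of each other and jointly independent of
`ℱ s`. (Paths are a.s. nondecreasing, so the subtraction in `ℕ` is a.s. the genuine one.) -/
structure IsPoissonPair (μ : Measure Ω) (ℱ : Filtration ℝ≥0 mΩ) (R₀ Rc : ℝ≥0)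
    (N Nc : ℝ≥0 → Ω → ℕ) : Prop where
  adapted_free : Adapted ℱ N
  adapted_costly : Adapted ℱ Nc
  path_free : ∀ᵐ ω ∂μ, N 0 ω = 0 ∧ Monotone (fun t => N t ω) ∧
    ∀ t, ContinuousWithinAt (fun r => N r ω) (Set.Ici t) t
  path_costly : ∀ᵐ ω ∂μ, Nc 0 ω = 0 ∧ Monotone (fun t => Nc t ω) ∧
    ∀ t, ContinuousWithinAt (fun r => Nc r ω) (Set.Ici t) t
  law_free : ∀ s t : ℝ≥0, s ≤ t →
    μ.map (fun ω => N t ω - N s ω) = poissonMeasure (R₀ * (t - s))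
  law_costly : ∀ s t : ℝ≥0, s ≤ t →
    μ.map (fun ω => Nc t ω - Nc s ω) = poissonMeasure (Rc * (t - s))
  indep_increments : ∀ s t : ℝ≥0, s ≤ t →
    IndepFun (fun ω => N t ω - N s ω) (fun ω => Nc t ω - Nc s ω) μ
  indep_past : ∀ s t : ℝ≥0, s ≤ t →
    Indep (ℱ s)
      (MeasurableSpace.comap (fun ω => (N t ω - N s ω, Nc t ω - Nc s ω)) inferInstance) μ

/-- The integral `∫_0^t u_s dn_s` of a function `u` against a counting path `n`: the sum of
`u s` times the jump of `n` at `s`, over the (finitely many) jump times `s ∈ (0, t]`. -/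
def jumpIntegral (u : ℝ≥0 → ℝ) (n : ℝ≥0 → ℕ) (t : ℝ≥0) : ℝ :=
  ∑ᶠ s ∈ Set.Ioc 0 t, u s * ((n s : ℝ) - Function.leftLim (fun r => (n r : ℝ)) s)

/-- `x` is the buffer-size process with initial buffer size `D` under the stationary policy `π`:
it is adapted and satisfies, almost surely for all `t`,
`x_t = D + N_t + ∫_0^t u_s dN^c_s - t`.
The action governing an arrival at time `s` is the one in force just before it,
`u_s = π (x_{s-})` (a packet cannot influence the decision to receive it). -/
structure IsBufferProcess (μ : Measure Ω) (ℱ : Filtration ℝ≥0 mΩ) (N Nc : ℝ≥0 → Ω → ℕ)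
    (π : MarkovPolicy) (D : ℝ) (x : ℝ≥0 → Ω → ℝ) : Prop where
  adapted : Adapted ℱ x
  dynamics : ∀ᵐ ω ∂μ, ∀ t : ℝ≥0,
    x t ω = D + (N t ω : ℝ)
      + jumpIntegral (fun s => ((π (Function.leftLim (fun r => x r ω) s)).val : ℝ))
          (fun s => Nc s ω) t
      - (t : ℝ)

/-- `τ_e = inf {t : x_t ≤ 0}`, with `inf ∅ = ∞`. -/
def tauE (x : ℝ≥0 → Ω → ℝ) (ω : Ω) : ℝ≥0∞ :=
  ⨅ (t : ℝ≥0) (_ : x t ω ≤ 0), (t : ℝ≥0∞)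

/-- `τ_f = inf {t : x_t ≥ F - t}`, with `inf ∅ = ∞`, for a file of size `F ∈ [0, ∞]`. -/
def tauF (F : ℝ≥0∞) (x : ℝ≥0 → Ω → ℝ) (ω : Ω) : ℝ≥0∞ :=
  ⨅ (t : ℝ≥0) (_ : (F : EReal) ≤ ((x t ω + (t : ℝ) : ℝ) : EReal)), (t : ℝ≥0∞)

/-- The interruption probability `P(τ_e < τ_f)` of the buffer process `x`. -/
def interruptionProb (μ : Measure Ω) (F : ℝ≥0∞) (x : ℝ≥0 → Ω → ℝ) : ℝ :=
  μ.real {ω | tauE x ω < tauF F x ω}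

/-- Feasibility at level `ε` for an infinite file: the interruption probability is at most `ε`. -/
def IsFeasible (μ : Measure Ω) (x : ℝ≥0 → Ω → ℝ) (ε : ℝ) : Prop :=
  interruptionProb μ ⊤ x ≤ ε

end Model

end Streaming

end

/-! ### Pathwise estimates for the buffer dynamics. -/

namespace Streaming

open Set Filter Topology Function

/-! The proof is a supermartingale argument with an explicit barrier `V`, carried out on a time
grid. Since `α₀` and `α₁` are roots of `r + R (e^{-r} - 1) = 0` for `R₀` and `R₁`, the function
`e^{-α₀ y}` is preserved in mean by drift plus free arrivals, and `a e^{-α₁ y} + b` by drift plus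
all arrivals.

For the risky policy, write `z = e^{-α₁ T}`. Take `V = a e^{-α₁ y} + b` below `T`, with value `1` at
`0` and `β z` at `T`; continue it by `K e^{-α₀ y}` above `T`, and cap it at `1`. If `β > 1` and `α₁
≤ β α₀`, the kink at `T` points the right way: the upper branch is the smaller one above `T`, the
lower branch is the smaller one just below (`highBarrier_le_lowBarrier`,
`lowBarrier_le_highBarrier`). So each branch still dominates `V` when the process crosses `T` during
a short step, and the mean of `V` cannot increase except through errors. The conditions on `β`
follow from `0 < α₀ < 2`.

Over a step of length `h`, the only error comes from two or more arrivals below `T`, of probability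
at most `(R₁ h)²`. Stopping at the first grid time with buffer at most `h` and summing the `L / h`
errors over `[0, L]` leaves `O(h)`. An interruption forces such a grid time, where `V` is at least
`V h → 1`; hence its probability is at most `V D` (`interruptionProb_le`).

It remains to see that `T* ≤ T` gives `V D ≤ ε` (`riskyBarrier_le`). If `β z ≥ 1`, this barrier is
unavailable, but then `e^{-α₀ D} ≤ ε` and the barrier of the free server alone suffices
(`exp_neg_le_of_one_le`). -/

lemma monotone_natCast_path {n : ℝ≥0 → ℕ} (hn : Monotone n) :
    Monotone (fun r => (n r : ℝ)) :=
  fun _ _ h => Nat.cast_le.2 (hn h)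

lemma leftLim_natCast_eq {n : ℝ≥0 → ℕ} {s t : ℝ≥0} (hst : s < t) {k : ℕ}
    (h : ∀ r, s ≤ r → r < t → n r = k) : leftLim (fun r => (n r : ℝ)) t = k := by
  have : (𝓝[<] t).NeBot := nhdsLT_neBot_of_exists_lt ⟨s, hst⟩
  refine leftLim_eq_of_tendsto ?_
  refine tendsto_const_nhds.congr' ?_
  filter_upwards [Ioo_mem_nhdsLT hst] with r hr
  rw [h r hr.1.le hr.2]

/-- The jump of a counting path at time `s`, weighted by `u s`. -/
noncomputable def weightedJump (u : ℝ≥0 → ℝ) (n : ℝ≥0 → ℕ) (s : ℝ≥0) : ℝ :=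
  u s * ((n s : ℝ) - leftLim (fun r => (n r : ℝ)) s)

lemma weightedJump_nonneg {u : ℝ≥0 → ℝ} (hu : ∀ s, 0 ≤ u s) {n : ℝ≥0 → ℕ} (hn : Monotone n)
    (s : ℝ≥0) : 0 ≤ weightedJump u n s :=
  mul_nonneg (hu s) (sub_nonneg.2 ((monotone_natCast_path hn).leftLim_le le_rfl))

/-- The path is injective on its jump times, and its values up to `t` are at most `n t`. Finiteness
matters because `finsum` over an infinite support is `0` by default, which would break additivity
and monotonicity of the integral. -/
lemma finite_support_weightedJump (u : ℝ≥0 → ℝ) {n : ℝ≥0 → ℕ} (hn : Monotone n) (s t : ℝ≥0) :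
    (Ioc s t ∩ support (weightedJump u n)).Finite := by
  refine Set.Finite.of_finite_image (f := n) ((finite_Iic (n t)).subset ?_) ?_
  · rintro _ ⟨r, hr, rfl⟩
    exact hn hr.1.2
  · have key : ∀ a b, b ∈ support (weightedJump u n) → a < b → n a ≠ n b := by
      intro a b hb hab he
      apply hb
      have h1 := (monotone_natCast_path hn).le_leftLim hab
      have h2 := (monotone_natCast_path hn).leftLim_le (le_refl b)
      have h3 : (n a : ℝ) = n b := by rw [he]
      have : (n b : ℝ) - leftLim (fun r => (n r : ℝ)) b = 0 := by
        linarith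
      simp [weightedJump, this]
    intro a ha b hb hab
    rcases lt_trichotomy a b with h | h | h
    · exact absurd hab (key a b hb.2 h)
    · exact h
    · exact absurd hab.symm (key b a ha.2 h)

lemma jumpIntegral_eq_add (u : ℝ≥0 → ℝ) {n : ℝ≥0 → ℕ} (hn : Monotone n) {s t : ℝ≥0}
    (hst : s ≤ t) :
    jumpIntegral u n t = jumpIntegral u n s + ∑ᶠ r ∈ Ioc s t, weightedJump u n r := by
  have h : Ioc 0 t = Ioc 0 s ∪ Ioc s t := (Ioc_union_Ioc_eq_Ioc zero_le hst).symm
  change (∑ᶠ r ∈ Ioc 0 t, weightedJump u n r) = (∑ᶠ r ∈ Ioc 0 s, weightedJump u n r) + _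
  rw [h]
  refine finsum_mem_union' ?_ (finite_support_weightedJump u hn _ _)
    (finite_support_weightedJump u hn _ _)
  exact Set.disjoint_left.2 fun r h1 h2 => absurd h1.2 (not_le.2 h2.1)

lemma jumpIntegral_mono {u : ℝ≥0 → ℝ} (hu : ∀ s, 0 ≤ u s) {n : ℝ≥0 → ℕ} (hn : Monotone n) :
    Monotone (jumpIntegral u n) := by
  intro s t hst
  rw [jumpIntegral_eq_add u hn hst]
  exact le_add_of_nonneg_right
    (finsum_nonneg fun r => finsum_nonneg fun _ => weightedJump_nonneg hu hn r)

lemma jumpIntegral_add_jump_le {u : ℝ≥0 → ℝ} (hu : ∀ s, 0 ≤ u s) {n : ℝ≥0 → ℕ}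
    (hn : Monotone n) {s r t : ℝ≥0} (hsr : s < r) (hrt : r ≤ t) :
    jumpIntegral u n s + weightedJump u n r ≤ jumpIntegral u n t := by
  rw [jumpIntegral_eq_add u hn (hsr.le.trans hrt), finsum_mem_def]
  have := single_le_finsum (f := (Ioc s t).indicator (weightedJump u n)) r
    ((finite_support_weightedJump u hn s t).subset (by rw [support_indicator]))
    (fun j => indicator_nonneg (fun r _ => weightedJump_nonneg hu hn r) j)
  rw [indicator_of_mem (show r ∈ Ioc s t from ⟨hsr, hrt⟩)] at this
  linarith

lemma jumpIntegral_eq_of_eq (u : ℝ≥0 → ℝ) {n : ℝ≥0 → ℕ} (hn : Monotone n) {s t : ℝ≥0}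
    (hst : s ≤ t) (h : n s = n t) : jumpIntegral u n t = jumpIntegral u n s := by
  rw [jumpIntegral_eq_add u hn hst, add_eq_left]
  refine finsum_mem_eq_zero_of_forall_eq_zero fun r hr => ?_
  have h0 : ∀ v, s ≤ v → v ≤ t → n v = n s := fun v h1 h2 =>
    le_antisymm (h ▸ hn h2) (hn h1)
  rw [weightedJump, leftLim_natCast_eq hr.1 (fun v h1 h2 => h0 v h1 (h2.le.trans hr.2)),
    h0 r hr.1.le hr.2, sub_self, mul_zero]

/-- A right-continuous counting path which increases on `(s, t]` has a first jump there. -/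
lemma exists_first_jump {n : ℝ≥0 → ℕ} (hn : Monotone n)
    (hc : ∀ t, ContinuousWithinAt n (Ici t) t) {s t : ℝ≥0} (h : n s < n t) :
    ∃ r, s < r ∧ r ≤ t ∧ n s < n r ∧ ∀ v, s ≤ v → v < r → n v = n s := by
  set A : Set ℝ≥0 := {v | n s < n v} with hA
  have htA : t ∈ A := h
  have hsb : ∀ v ∈ A, s ≤ v := fun v hv => by
    by_contra hlt
    exact absurd (hn (not_le.1 hlt).le) (not_le.2 hv)
  have hrA : n s < n (sInf A) := by
    -- Right-continuity into the discrete space `ℕ` means local constancy to the right, so the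
    -- infimum of `A` is attained.
    have h1 : ∀ᶠ v in 𝓝[≥] (sInf A), n v = n (sInf A) := by
      have := hc (sInf A)
      rw [ContinuousWithinAt, nhds_discrete, tendsto_pure] at this
      exact this
    rw [eventually_nhdsWithin_iff, Metric.eventually_nhds_iff] at h1
    obtain ⟨δ, hδ, h1⟩ := h1
    obtain ⟨v, hv, hvlt⟩ := exists_lt_of_csInf_lt ⟨t, htA⟩
      (lt_add_of_pos_right (sInf A) (Real.toNNReal_pos.2 hδ))
    have hle : sInf A ≤ v := csInf_le (OrderBot.bddBelow A) hv
    have hd : dist v (sInf A) < δ := by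
      rw [NNReal.dist_eq, abs_of_nonneg (sub_nonneg.2 (NNReal.coe_le_coe.2 hle))]
      have := NNReal.coe_lt_coe.2 hvlt
      rw [NNReal.coe_add, Real.coe_toNNReal _ hδ.le] at this
      linarith
    rw [← h1 hd hle]
    exact hv
  refine ⟨sInf A, ?_, csInf_le (OrderBot.bddBelow A) htA, hrA, fun v hv hvr => ?_⟩
  · refine lt_of_le_of_ne (le_csInf ⟨t, htA⟩ hsb) ?_
    intro he
    rw [← he] at hrA
    exact lt_irrefl _ hrA
  · refine le_antisymm (not_lt.1 fun hlt => ?_) (hn hv)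
    exact absurd (csInf_le (OrderBot.bddBelow A) hlt) (not_le.2 hvr)

/-- A path of the buffer-size dynamics driven by two right-continuous counting paths. -/
structure IsBufferPath (π : MarkovPolicy) (D : ℝ) (n m : ℝ≥0 → ℕ) (y : ℝ≥0 → ℝ) : Prop where
  free_zero : n 0 = 0
  free_mono : Monotone n
  costly_mono : Monotone m
  costly_cont : ∀ t, ContinuousWithinAt m (Ici t) t
  dynamics : ∀ t, y t = D + (n t : ℝ) + jumpIntegral (fun s => ((π (leftLim y s)).val : ℝ)) m t - t

namespace IsBufferPath

variable {π : MarkovPolicy} {D T : ℝ} {n m : ℝ≥0 → ℕ} {y : ℝ≥0 → ℝ}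

lemma initial (h : IsBufferPath π D n m y) : y 0 = D := by
  rw [h.dynamics, h.free_zero]
  simp [jumpIntegral]

lemma add_free_le (h : IsBufferPath π D n m y) {s t : ℝ≥0} (hst : s ≤ t) :
    y s - (t - s) + ((n t - n s : ℕ) : ℝ) ≤ y t := by
  have := jumpIntegral_mono (u := fun s => ((π (leftLim y s)).val : ℝ))
    (fun _ => Nat.cast_nonneg _) h.costly_mono hst
  rw [h.dynamics s, h.dynamics t, Nat.cast_sub (h.free_mono hst)]
  linarith

lemma sub_le (h : IsBufferPath π D n m y) {s t : ℝ≥0} (hst : s ≤ t) :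
    y s - (t - s) ≤ y t := by
  have := h.add_free_le hst
  have h2 : (0 : ℝ) ≤ ((n t - n s : ℕ) : ℝ) := Nat.cast_nonneg _
  linarith

/-- As long as the buffer stays in `(0, T)`, a single arrival is received under the risky policy. -/
lemma add_total_le (h : IsBufferPath (riskyPolicy T) D n m y) {s t : ℝ≥0} (hst : s ≤ t)
    (hpos : (t : ℝ) - s < y s) (hT : y s < T) (h1 : (n t - n s) + (m t - m s) ≤ 1) :
    y s - (t - s) + (((n t - n s) + (m t - m s) : ℕ) : ℝ) ≤ y t := by
  rcases Nat.eq_zero_or_pos (m t - m s) with h0 | h0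
  · rw [h0, add_zero]
    exact h.add_free_le hst
  have hm : m t - m s = 1 := by omega
  have hn : n t - n s = 0 := by omega
  have hnst : n s = n t := le_antisymm (h.free_mono hst) (Nat.sub_eq_zero_iff_le.1 hn)
  obtain ⟨r, hsr, hrt, hjump, hconst⟩ :=
    exists_first_jump h.costly_mono h.costly_cont (show m s < m t by omega)
  -- Before the first costly arrival `r` nothing arrives, so the buffer only drifts and its left
  -- limit at `r` lies in `(0, T)`: the costly packet is accepted.
  have hlim : leftLim y r = y s - (r - s) := by
    have hne : (𝓝[<] r).NeBot := nhdsLT_neBot_of_exists_lt ⟨s, hsr⟩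
    refine leftLim_eq_of_tendsto ?_
    have hc : Tendsto (fun v : ℝ≥0 => y s - ((v : ℝ) - s)) (𝓝[<] r) (𝓝 (y s - (r - s))) := by
      have : Continuous (fun v : ℝ≥0 => y s - ((v : ℝ) - s)) := by fun_prop
      exact this.continuousWithinAt
    refine hc.congr' ?_
    filter_upwards [Ioo_mem_nhdsLT hsr] with v hv
    have hnv : n v = n s :=
      le_antisymm (hnst ▸ h.free_mono (hv.2.le.trans hrt)) (h.free_mono hv.1.le)
    rw [h.dynamics v, h.dynamics s, hnv, jumpIntegral_eq_of_eq _ h.costly_mono hv.1.le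
      (hconst v hv.1.le hv.2).symm]
    ring
  have hsr' : (s : ℝ) < r := hsr
  have hrt' : (r : ℝ) ≤ t := hrt
  have hu : riskyPolicy T (leftLim y r) = 1 := by
    rw [hlim, riskyPolicy, if_pos]
    constructor <;> linarith
  have hmr : (1 : ℝ) + m s ≤ m r := by
    have : 1 + m s ≤ m r := by omega
    exact_mod_cast this
  have hJ := jumpIntegral_add_jump_le (u := fun s => ((riskyPolicy T (leftLim y s)).val : ℝ))
    (fun _ => Nat.cast_nonneg _) h.costly_mono hsr hrt
  simp only [weightedJump, hu, leftLim_natCast_eq hsr hconst] at hJ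
  rw [hm, hn, h.dynamics s, h.dynamics t, ← hnst]
  norm_num at hJ ⊢
  linarith

end IsBufferPath

end Streaming

/-! ### Exponential moments of Poisson increments and one-step barrier estimates. -/

namespace Streaming

open Set Filter Topology Function

lemma integral_exp_poissonMeasure (l : ℝ≥0) (a : ℝ) :
    ∫ k, Real.exp (-(a * k)) ∂(poissonMeasure l) = Real.exp (l * (Real.exp (-a) - 1)) := by
  rw [integral_poissonMeasure]
  have h := (NormedSpace.expSeries_div_hasSum_exp ((l : ℝ) * Real.exp (-a))).tsum_eq
  rw [← Real.exp_eq_exp_ℝ] at h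
  calc ∑' k : ℕ, (Real.exp (-l) * (l : ℝ) ^ k / (k.factorial : ℝ)) • Real.exp (-(a * k))
      = ∑' k : ℕ, Real.exp (-l) * (((l : ℝ) * Real.exp (-a)) ^ k / (k.factorial : ℝ)) := by
        congr with k
        rw [mul_pow, ← Real.exp_nat_mul, smul_eq_mul]
        ring_nf
    _ = Real.exp (l * (Real.exp (-a) - 1)) := by
        rw [tsum_mul_left, h, ← Real.exp_add]
        ring_nf

/-- From `e^{-l} ≥ 1 - l` one gets `1 - (1 + l) e^{-l} ≤ l²`. The quadratic order makes the
accumulated error vanish as the grid is refined. -/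
lemma poissonMeasure_real_two_le (l : ℝ≥0) : (poissonMeasure l).real {k | 2 ≤ k} ≤ (l : ℝ) ^ 2 := by
  have hc : {k : ℕ | 2 ≤ k} = ({0, 1} : Set ℕ)ᶜ := by
    ext k
    simp only [mem_ofPred_eq, mem_compl_iff, mem_insert_iff, mem_singleton_iff]
    omega
  have h2 : ({0, 1} : Set ℕ) = {0} ∪ {1} := rfl
  rw [hc, probReal_compl_eq_one_sub .of_discrete, h2,
    measureReal_union (by simp) .of_discrete, poissonMeasure_real_singleton,
    poissonMeasure_real_singleton]
  have h1 := Real.add_one_le_exp (-(l : ℝ))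
  have h0 : (0 : ℝ) ≤ l := l.2
  simp only [pow_zero, pow_one, Nat.factorial, Nat.cast_one, mul_one, div_one]
  norm_num
  nlinarith

variable {Ω : Type*} {m mΩ : MeasurableSpace Ω} {μ : Measure Ω}

/-- If `α + R (e^{-α} - 1) = 0`, then `exp (-α z)` is preserved in mean when `z` drifts by `-d`
and receives an independent Poisson number of arrivals with mean `R d`. -/
lemma setIntegral_exp_add_poisson (hm : m ≤ mΩ) {Y : Ω → ℕ}
    (hY : Measurable Y) (hind : Indep m (MeasurableSpace.comap Y inferInstance) μ) {R d : ℝ≥0}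
    (hlaw : μ.map Y = poissonMeasure (R * d)) {B : Set Ω} (hB : MeasurableSet[m] B) {f : Ω → ℝ}
    (hf : Measurable[m] f) {α : ℝ} (hα : α + R * (Real.exp (-α) - 1) = 0) :
    ∫ ω in B, Real.exp (-(α * (f ω - d + Y ω))) ∂μ = ∫ ω in B, Real.exp (-(α * f ω)) ∂μ := by
  set g : Ω → ℝ := B.indicator fun ω => Real.exp (-(α * f ω)) with hg
  have hgm : Measurable[m] g :=
    Measurable.indicator (Real.measurable_exp.comp (hf.const_mul α).neg) hB
  set φ : Ω → ℝ := fun ω => Real.exp (-(α * Y ω)) with hφ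
  have hφm : Measurable[MeasurableSpace.comap Y inferInstance] φ := by
    have h1 : Measurable (fun k : ℕ => Real.exp (-(α * k))) := .of_discrete
    exact h1.comp (comap_measurable Y)
  have hφm' : Measurable φ := hφm.mono hY.comap_le le_rfl
  have hgφ : IndepFun g φ μ :=
    indep_of_indep_of_le_right (indep_of_indep_of_le_left hind hgm.comap_le) hφm.comap_le
  have hφint : ∫ ω, φ ω ∂μ = Real.exp (-(α * d)) := by
    have h2 := integral_map (μ := μ) hY.aemeasurable
      (f := fun k : ℕ => Real.exp (-(α * k))) (by fun_prop)
    rw [hlaw, integral_exp_poissonMeasure] at h2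
    rw [← h2]
    congr 1
    push_cast
    linear_combination (d : ℝ) * hα
  have hmul := hgφ.integral_fun_mul_eq_mul_integral
    (hgm.mono hm le_rfl).aestronglyMeasurable hφm'.aestronglyMeasurable
  rw [← integral_indicator (hm _ hB), ← integral_indicator (hm _ hB)]
  calc ∫ ω, B.indicator (fun ω => Real.exp (-(α * (f ω - d + Y ω)))) ω ∂μ
      = ∫ ω, Real.exp (α * d) * (g ω * φ ω) ∂μ := by
        congr with ω
        by_cases hω : ω ∈ B
        · simp only [hg, hφ, indicator_of_mem hω, ← Real.exp_add]
          ring_nf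
        · simp [hg, hω]
    _ = ∫ ω, g ω ∂μ := by
        rw [integral_const_mul, hmul, hφint, mul_left_comm, ← Real.exp_add]
        simp

lemma integrableOn_exp_of_nonneg [IsFiniteMeasure μ] {B : Set Ω} (hB : MeasurableSet B) {f : Ω → ℝ}
    (hf : Measurable f) {α : ℝ} (hα : 0 ≤ α) (h0 : ∀ ω ∈ B, 0 ≤ f ω) :
    IntegrableOn (fun ω => Real.exp (-(α * f ω))) B μ := by
  refine Integrable.of_bound (C := 1) (by fun_prop) ?_
  refine (ae_restrict_iff' hB).2 (.of_forall fun ω hω => ?_)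
  rw [Real.norm_eq_abs, Real.abs_exp, Real.exp_le_one_iff, neg_nonpos]
  exact mul_nonneg hα (h0 ω hω)

namespace IsPoissonPair

variable {ℱ : Filtration ℝ≥0 mΩ} {R₀ Rc : ℝ≥0} {N Nc : ℝ≥0 → Ω → ℕ}

lemma measurable_free_sub (h : IsPoissonPair μ ℱ R₀ Rc N Nc) (s t : ℝ≥0) :
    Measurable (fun ω => N t ω - N s ω) :=
  ((h.adapted_free t).mono (ℱ.le t) le_rfl).sub ((h.adapted_free s).mono (ℱ.le s) le_rfl)

lemma measurable_costly_sub (h : IsPoissonPair μ ℱ R₀ Rc N Nc) (s t : ℝ≥0) :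
    Measurable (fun ω => Nc t ω - Nc s ω) :=
  ((h.adapted_costly t).mono (ℱ.le t) le_rfl).sub ((h.adapted_costly s).mono (ℱ.le s) le_rfl)

lemma indep_past_comp (h : IsPoissonPair μ ℱ R₀ Rc N Nc) {s t : ℝ≥0} (hst : s ≤ t)
    (φ : ℕ × ℕ → ℕ) :
    Indep (ℱ s) (MeasurableSpace.comap (fun ω => φ (N t ω - N s ω, Nc t ω - Nc s ω))
      inferInstance) μ := by
  refine indep_of_indep_of_le_right (h.indep_past s t hst) ?_
  have hφ : Measurable φ := .of_discrete
  have := (hφ.comp (comap_measurable (fun ω => (N t ω - N s ω, Nc t ω - Nc s ω)))).comap_le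
  exact this

lemma law_total (h : IsPoissonPair μ ℱ R₀ Rc N Nc) {s t : ℝ≥0} (hst : s ≤ t) :
    μ.map (fun ω => (N t ω - N s ω) + (Nc t ω - Nc s ω)) =
      poissonMeasure ((R₀ + Rc) * (t - s)) := by
  have := (h.indep_increments s t hst).hasLaw_add_poissonMeasure
    ⟨(h.measurable_free_sub s t).aemeasurable, h.law_free s t hst⟩
    ⟨(h.measurable_costly_sub s t).aemeasurable, h.law_costly s t hst⟩
  rw [add_mul]
  exact this.map_eq

end IsPoissonPair

lemma ae_isBufferPath {ℱ : Filtration ℝ≥0 mΩ} {R₀ Rc : ℝ≥0} {N Nc : ℝ≥0 → Ω → ℕ}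
    (hN : IsPoissonPair μ ℱ R₀ Rc N Nc) {π : MarkovPolicy} {D : ℝ} {x : ℝ≥0 → Ω → ℝ}
    (hx : IsBufferProcess μ ℱ N Nc π D x) :
    ∀ᵐ ω ∂μ, IsBufferPath π D (fun t => N t ω) (fun t => Nc t ω) (fun t => x t ω) := by
  filter_upwards [hN.path_free, hN.path_costly, hx.dynamics] with ω h1 h2 h3
  exact ⟨h1.1, h1.2.1, h2.2.1, h2.2.2, h3⟩

/-- A piecewise exponential barrier for the buffer process under the policy with threshold `T`:
it has the form `a e^{-α₁ y} + b` on `(0, S)` and `K e^{-α₀ y}` on `[S, ∞)`, and is dominated by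
the first expression everywhere and by the second one slightly below `S`. -/
structure IsBarrier (α₀ α₁ T : ℝ) (V : ℝ → ℝ) (S a b K δ : ℝ) : Prop where
  antitone : Antitone V
  nonneg : ∀ y, 0 ≤ V y
  le_one : ∀ y, V y ≤ 1
  tendsto_zero : Tendsto V (𝓝[≥] 0) (𝓝 1)
  lt_threshold : ∀ y, 0 < y → y < S → y < T
  a_nonneg : 0 ≤ a
  b_nonneg : 0 ≤ b
  delta_pos : 0 < δ
  eq_low : ∀ y, 0 < y → y < S → V y = a * Real.exp (-(α₁ * y)) + b
  le_low : ∀ y, 0 < y → V y ≤ a * Real.exp (-(α₁ * y)) + b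
  eq_high : ∀ y, 0 < y → S ≤ y → V y = K * Real.exp (-(α₀ * y))
  le_high : ∀ y, 0 < y → S - δ ≤ y → V y ≤ K * Real.exp (-(α₀ * y))

namespace IsBarrier

variable {ℱ : Filtration ℝ≥0 mΩ} {R₀ Rc : ℝ≥0} {N Nc : ℝ≥0 → Ω → ℕ}
  {α₀ α₁ T D : ℝ} {V : ℝ → ℝ} {S a b K δ : ℝ} {x : ℝ≥0 → Ω → ℝ}

lemma integrableOn_comp [IsFiniteMeasure μ] (hV : IsBarrier α₀ α₁ T V S a b K δ) {f : Ω → ℝ} (hf : Measurable f)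
    (B : Set Ω) : IntegrableOn (fun ω => V (f ω)) B μ := by
  refine Integrable.of_bound (C := 1) (hV.antitone.measurable.comp hf).aestronglyMeasurable ?_
  refine .of_forall fun ω => ?_
  rw [Real.norm_eq_abs, abs_of_nonneg (hV.nonneg _)]
  exact hV.le_one _

/-- With at most one arrival from the two servers together, it is accepted, and `V` is dominated by
the low branch wherever the buffer lands. With more arrivals the policy may switch within the step,
so `V ≤ 1` is used and the probability of this event is the error term. -/
lemma setIntegral_le_of_low [IsProbabilityMeasure μ] (hV : IsBarrier α₀ α₁ T V S a b K δ)
    (hN : IsPoissonPair μ ℱ R₀ Rc N Nc) (hx : IsBufferProcess μ ℱ N Nc (riskyPolicy T) D x)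
    (hα₁ : 0 ≤ α₁) (hroot : α₁ + ((R₀ + Rc : ℝ≥0) : ℝ) * (Real.exp (-α₁) - 1) = 0)
    {s t : ℝ≥0} (hst : s ≤ t) {B : Set Ω} (hB : MeasurableSet[ℱ s] B)
    (hpos : ∀ ω ∈ B, (t : ℝ) - s < x s ω) (hlow : ∀ ω ∈ B, x s ω < S) :
    ∫ ω in B, V (x t ω) ∂μ ≤
      ∫ ω in B, V (x s ω) ∂μ + (((R₀ + Rc : ℝ≥0) : ℝ) * (t - s)) ^ 2 := by
  have hst' : (s : ℝ) ≤ t := hst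
  have hBm : MeasurableSet B := ℱ.le s _ hB
  have hxs : Measurable (x s) := (hx.adapted s).mono (ℱ.le s) le_rfl
  have hxt : Measurable (x t) := (hx.adapted t).mono (ℱ.le t) le_rfl
  set Y : Ω → ℕ := fun ω => (N t ω - N s ω) + (Nc t ω - Nc s ω) with hYdef
  have hY : Measurable Y := (hN.measurable_free_sub s t).add (hN.measurable_costly_sub s t)
  have hd : ((t - s : ℝ≥0) : ℝ) = t - s := NNReal.coe_sub hst
  have hE := setIntegral_exp_add_poisson (ℱ.le s) hY
    (hN.indep_past_comp hst fun p => p.1 + p.2) (hN.law_total hst) hB (hx.adapted s) hroot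
  set L : Set Ω := {ω | 2 ≤ Y ω} with hL
  have hLm : MeasurableSet L := hY (MeasurableSet.of_discrete (s := {k : ℕ | 2 ≤ k}))
  have hLμ : μ.real L ≤ (((R₀ + Rc : ℝ≥0) : ℝ) * (t - s)) ^ 2 := by
    have h1 := poissonMeasure_real_two_le ((R₀ + Rc) * (t - s))
    rw [← hN.law_total hst, map_measureReal_apply hY .of_discrete, NNReal.coe_mul, hd] at h1
    exact h1
  have hi1 : IntegrableOn (fun ω => Real.exp (-(α₁ * (x s ω - (t - s : ℝ≥0) + Y ω)))) B μ := by
    refine integrableOn_exp_of_nonneg (f := fun ω => x s ω - (t - s : ℝ≥0) + Y ω) hBm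
      (by fun_prop) hα₁ fun ω hω => ?_
    have := hpos ω hω
    have h2 : (0 : ℝ) ≤ Y ω := Nat.cast_nonneg _
    rw [hd]
    linarith
  have hi2 : IntegrableOn (fun ω => Real.exp (-(α₁ * x s ω))) B μ :=
    integrableOn_exp_of_nonneg hBm hxs hα₁ fun ω hω => by linarith [hpos ω hω]
  have hic : IntegrableOn (fun _ : Ω => b) B μ := integrable_const b
  have hi3 : IntegrableOn (L.indicator fun _ => (1 : ℝ)) B μ :=
    (integrable_const (1 : ℝ)).indicator hLm
  have hi4 : IntegrableOn
      (fun ω => a * Real.exp (-(α₁ * (x s ω - (t - s : ℝ≥0) + Y ω))) + b) B μ :=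
    (hi1.const_mul a).add hic
  have hle : ∫ ω in B, V (x t ω) ∂μ ≤
      ∫ ω in B, ((a * Real.exp (-(α₁ * (x s ω - (t - s : ℝ≥0) + Y ω))) + b) +
        L.indicator (fun _ => (1 : ℝ)) ω) ∂μ := by
    refine setIntegral_mono_on_ae (hV.integrableOn_comp hxt B) (hi4.add hi3) hBm ?_
    filter_upwards [ae_isBufferPath hN hx] with ω hpath hω
    have hp := hpos ω hω
    have hY0 : (0 : ℝ) ≤ Y ω := Nat.cast_nonneg _
    rw [hd]
    by_cases hωL : ω ∈ L
    · rw [indicator_of_mem hωL]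
      have h1 := hV.le_one (x t ω)
      have h2 : 0 ≤ a * Real.exp (-(α₁ * (x s ω - (t - s) + Y ω))) :=
        mul_nonneg hV.a_nonneg (Real.exp_nonneg _)
      linarith [hV.b_nonneg]
    · rw [indicator_of_notMem hωL, add_zero]
      have hY1 : Y ω ≤ 1 := by
        simp only [hL, mem_ofPred_eq] at hωL
        omega
      have hTx : x s ω < T := hV.lt_threshold _ (by linarith) (hlow ω hω)
      exact (hV.antitone (hpath.add_total_le hst hp hTx hY1)).trans
        (hV.le_low _ (by linarith))
  have hVs : ∫ ω in B, V (x s ω) ∂μ = ∫ ω in B, (a * Real.exp (-(α₁ * x s ω)) + b) ∂μ :=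
    setIntegral_congr_fun hBm fun ω hω =>
      hV.eq_low _ (by linarith [hpos ω hω]) (hlow ω hω)
  have hL' : ∫ ω in B, L.indicator (fun _ => (1 : ℝ)) ω ∂μ ≤ μ.real L := by
    rw [integral_indicator hLm, integral_const, smul_eq_mul, mul_one, measureReal_restrict_apply_univ,
      measureReal_restrict_apply hLm]
    exact measureReal_mono inter_subset_left
  rw [integral_add hi4 hi3, integral_add (hi1.const_mul a) hic, integral_const_mul, hE] at hle
  rw [hVs, integral_add (hi2.const_mul a) hic, integral_const_mul]
  linarith

/-- Discarding costly arrivals only lowers the buffer, hence raises `V`. The drift takes it at most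
`δ` below `S`, where the high branch still dominates, so there is no error term. -/
lemma setIntegral_le_of_high [IsProbabilityMeasure μ] (hV : IsBarrier α₀ α₁ T V S a b K δ)
    (hN : IsPoissonPair μ ℱ R₀ Rc N Nc) {π : MarkovPolicy} (hx : IsBufferProcess μ ℱ N Nc π D x)
    (hα₀ : 0 ≤ α₀) (hroot : α₀ + (R₀ : ℝ) * (Real.exp (-α₀) - 1) = 0)
    {s t : ℝ≥0} (hst : s ≤ t) (hδ : (t : ℝ) - s ≤ δ) {B : Set Ω} (hB : MeasurableSet[ℱ s] B)
    (hpos : ∀ ω ∈ B, (t : ℝ) - s < x s ω) (hhigh : ∀ ω ∈ B, S ≤ x s ω) :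
    ∫ ω in B, V (x t ω) ∂μ ≤ ∫ ω in B, V (x s ω) ∂μ := by
  have hst' : (s : ℝ) ≤ t := hst
  have hBm : MeasurableSet B := ℱ.le s _ hB
  have hxs : Measurable (x s) := (hx.adapted s).mono (ℱ.le s) le_rfl
  have hxt : Measurable (x t) := (hx.adapted t).mono (ℱ.le t) le_rfl
  set Y : Ω → ℕ := fun ω => N t ω - N s ω with hYdef
  have hY : Measurable Y := hN.measurable_free_sub s t
  have hd : ((t - s : ℝ≥0) : ℝ) = t - s := NNReal.coe_sub hst
  have hE := setIntegral_exp_add_poisson (ℱ.le s) hY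
    (hN.indep_past_comp hst fun p => p.1) (hN.law_free s t hst) hB (hx.adapted s) hroot
  have hi1 : IntegrableOn (fun ω => Real.exp (-(α₀ * (x s ω - (t - s : ℝ≥0) + Y ω)))) B μ := by
    refine integrableOn_exp_of_nonneg (f := fun ω => x s ω - (t - s : ℝ≥0) + Y ω) hBm
      (by fun_prop) hα₀ fun ω hω => ?_
    have := hpos ω hω
    have h2 : (0 : ℝ) ≤ Y ω := Nat.cast_nonneg _
    rw [hd]
    linarith
  have hle : ∫ ω in B, V (x t ω) ∂μ ≤
      ∫ ω in B, K * Real.exp (-(α₀ * (x s ω - (t - s : ℝ≥0) + Y ω))) ∂μ := by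
    refine setIntegral_mono_on_ae (hV.integrableOn_comp hxt B) (hi1.const_mul K) hBm ?_
    filter_upwards [ae_isBufferPath hN hx] with ω hpath hω
    have hp := hpos ω hω
    have hh := hhigh ω hω
    have hY0 : (0 : ℝ) ≤ Y ω := Nat.cast_nonneg _
    rw [hd]
    exact (hV.antitone (hpath.add_free_le hst)).trans
      (hV.le_high _ (by linarith) (by linarith))
  have hVs : ∫ ω in B, V (x s ω) ∂μ = ∫ ω in B, K * Real.exp (-(α₀ * x s ω)) ∂μ :=
    setIntegral_congr_fun hBm fun ω hω =>
      hV.eq_high _ (by linarith [hpos ω hω]) (hhigh ω hω)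
  rw [hVs]
  rwa [integral_const_mul, hE, ← integral_const_mul] at hle

end IsBarrier

end Streaming

/-! ### From single steps to the interruption probability. -/

namespace Streaming

open Set Filter Topology Function

variable {Ω : Type*} {mΩ : MeasurableSpace Ω} {μ : Measure Ω}

/-- The event that the process exceeds the level `d` at the times `0, d, …, k d`. -/
def gridSurvival (x : ℝ≥0 → Ω → ℝ) (d : ℝ≥0) (k : ℕ) : Set Ω :=
  {ω | ∀ j ≤ k, (d : ℝ) < x (j * d) ω}

namespace IsBarrier

variable {ℱ : Filtration ℝ≥0 mΩ} {R₀ Rc : ℝ≥0} {N Nc : ℝ≥0 → Ω → ℕ}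
  {α₀ α₁ T D : ℝ} {V : ℝ → ℝ} {S a b K δ : ℝ} {x : ℝ≥0 → Ω → ℝ}

lemma measurableSet_gridSurvival (hx : IsBufferProcess μ ℱ N Nc (riskyPolicy T) D x) (d : ℝ≥0)
    (k : ℕ) : MeasurableSet[ℱ (k * d)] (gridSurvival x d k) := by
  have : gridSurvival x d k = ⋂ j : ℕ, ⋂ _ : j ≤ k, {ω | (d : ℝ) < x (j * d) ω} := by
    ext ω
    simp [gridSurvival]
  rw [this]
  refine MeasurableSet.iInter fun j => MeasurableSet.iInter fun hj => ?_
  have hle : (j : ℝ≥0) * d ≤ k * d := by gcongr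
  exact ℱ.mono hle _ (measurableSet_lt measurable_const (hx.adapted (j * d)))

lemma setIntegral_step_le [IsProbabilityMeasure μ] (hV : IsBarrier α₀ α₁ T V S a b K δ)
    (hN : IsPoissonPair μ ℱ R₀ Rc N Nc) (hx : IsBufferProcess μ ℱ N Nc (riskyPolicy T) D x)
    (hα₀ : 0 ≤ α₀) (hroot₀ : α₀ + (R₀ : ℝ) * (Real.exp (-α₀) - 1) = 0)
    (hα₁ : 0 ≤ α₁) (hroot₁ : α₁ + ((R₀ + Rc : ℝ≥0) : ℝ) * (Real.exp (-α₁) - 1) = 0)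
    {s t : ℝ≥0} (hst : s ≤ t) (hδ : (t : ℝ) - s ≤ δ) {B : Set Ω} (hB : MeasurableSet[ℱ s] B)
    (hpos : ∀ ω ∈ B, (t : ℝ) - s < x s ω) :
    ∫ ω in B, V (x t ω) ∂μ ≤
      ∫ ω in B, V (x s ω) ∂μ + (((R₀ + Rc : ℝ≥0) : ℝ) * (t - s)) ^ 2 := by
  have hxs : Measurable (x s) := (hx.adapted s).mono (ℱ.le s) le_rfl
  have hxt : Measurable (x t) := (hx.adapted t).mono (ℱ.le t) le_rfl
  set C : Set Ω := {ω | x s ω < S} with hC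
  have hCs : MeasurableSet[ℱ s] C := measurableSet_lt (hx.adapted s) measurable_const
  have hCm : MeasurableSet C := ℱ.le s _ hCs
  have h1 := hV.setIntegral_le_of_low hN hx hα₁ hroot₁ hst (hB.inter hCs)
    (fun ω hω => hpos ω hω.1) (fun ω hω => hω.2)
  have h2 := hV.setIntegral_le_of_high hN hx hα₀ hroot₀ hst hδ (hB.diff hCs)
    (fun ω hω => hpos ω hω.1) (fun ω hω => not_lt.1 hω.2)
  rw [← integral_inter_add_sdiff hCm (hV.integrableOn_comp hxt B),
    ← integral_inter_add_sdiff hCm (hV.integrableOn_comp hxs B)]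
  linarith

/-- This is the supermartingale inequality for the process stopped at the first grid time with
buffer at most `d`. Paths lost at each step contribute at least `V d` times their probability,
because `V` is antitone. -/
lemma gridSurvival_bound [IsProbabilityMeasure μ] (hV : IsBarrier α₀ α₁ T V S a b K δ)
    (hN : IsPoissonPair μ ℱ R₀ Rc N Nc) (hx : IsBufferProcess μ ℱ N Nc (riskyPolicy T) D x)
    (hα₀ : 0 ≤ α₀) (hroot₀ : α₀ + (R₀ : ℝ) * (Real.exp (-α₀) - 1) = 0)
    (hα₁ : 0 ≤ α₁) (hroot₁ : α₁ + ((R₀ + Rc : ℝ≥0) : ℝ) * (Real.exp (-α₁) - 1) = 0)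
    {d : ℝ≥0} (hδ : (d : ℝ) ≤ δ) (k : ℕ) :
    V d * μ.real (gridSurvival x d k)ᶜ + ∫ ω in gridSurvival x d k, V (x (k * d) ω) ∂μ ≤
      V D + k * (((R₀ + Rc : ℝ≥0) : ℝ) * d) ^ 2 := by
  have hm : ∀ k, MeasurableSet (gridSurvival x d k) := fun k =>
    ℱ.le _ _ (measurableSet_gridSurvival hx d k)
  have hxm : ∀ t, Measurable (x t) := fun t => (hx.adapted t).mono (ℱ.le t) le_rfl
  have hsplit : ∀ (C : Set Ω) (t : ℝ≥0), MeasurableSet C → (∀ ω ∈ C, x t ω ≤ d) →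
      V d * μ.real C ≤ ∫ ω in C, V (x t ω) ∂μ := by
    intro C t hC hle
    have h1 : ∫ ω in C, V d ∂μ ≤ ∫ ω in C, V (x t ω) ∂μ :=
      setIntegral_mono_on (integrable_const _) (hV.integrableOn_comp (hxm t) C) hC
        fun ω hω => hV.antitone (hle ω hω)
    rwa [setIntegral_const, smul_eq_mul, mul_comm] at h1
  induction k with
  | zero =>
    have h0 : ∀ᵐ ω ∂μ, x 0 ω = D := by
      filter_upwards [ae_isBufferPath hN hx] with ω h
      exact h.initial
    have h1 : ∫ ω, V (x 0 ω) ∂μ = V D := by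
      rw [integral_congr_ae (g := fun _ => V D) (by filter_upwards [h0] with ω h; rw [h])]
      simp
    have h2 := integral_add_compl (hm 0) (integrableOn_univ.1 (hV.integrableOn_comp (μ := μ) (hxm 0) univ))
    have h3 := hsplit (gridSurvival x d 0)ᶜ 0 (hm 0).compl (fun ω hω => by
      by_contra hlt
      refine hω fun j hj => ?_
      rw [Nat.le_zero.1 hj, Nat.cast_zero, zero_mul]
      exact not_le.1 hlt)
    simp only [Nat.cast_zero, zero_mul, add_zero]
    linarith
  | succ k ih =>
    have hle : (k : ℝ≥0) * d ≤ (k + 1 : ℕ) * d := by gcongr; omega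
    have hd : (((k + 1 : ℕ) * d : ℝ≥0) : ℝ) - ((k * d : ℝ≥0) : ℝ) = d := by
      push_cast
      ring
    have h1 := hV.setIntegral_step_le hN hx hα₀ hroot₀ hα₁ hroot₁ hle (by rwa [hd])
      (measurableSet_gridSurvival hx d k) (fun ω hω => by rw [hd]; exact hω k le_rfl)
    rw [hd] at h1
    have hsub : gridSurvival x d (k + 1) ⊆ gridSurvival x d k := fun ω hω j hj =>
      hω j (hj.trans k.le_succ)
    have h2 := integral_inter_add_sdiff (hm (k + 1))
      (hV.integrableOn_comp (μ := μ) (hxm ((k + 1 : ℕ) * d)) (gridSurvival x d k))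
    rw [inter_eq_right.2 hsub] at h2
    have h3 := hsplit (gridSurvival x d k \ gridSurvival x d (k + 1)) ((k + 1 : ℕ) * d)
      ((hm k).diff (hm (k + 1))) (fun ω hω => by
        by_contra hlt
        refine hω.2 fun j hj => ?_
        rcases Nat.le_succ_iff.1 hj with h | h
        · exact hω.1 j h
        · rw [h]
          exact not_le.1 hlt)
    have h4 : μ.real (gridSurvival x d (k + 1))ᶜ =
        μ.real (gridSurvival x d k)ᶜ + μ.real (gridSurvival x d k \ gridSurvival x d (k + 1)) := by
      rw [← measureReal_union _ ((hm k).diff (hm (k + 1)))]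
      · congr 1
        ext ω
        have := @hsub ω
        simp only [mem_compl_iff, mem_union, Set.mem_sdiff]
        tauto
      · exact Set.disjoint_left.2 fun ω h5 h6 => h5 h6.1
    rw [h4]
    push_cast at *
    nlinarith

/-- The buffer path cannot reach `0` without being at most `d` at the preceding grid time. -/
lemma _root_.Streaming.IsBufferPath.exists_grid_le {π : MarkovPolicy} {n m : ℝ≥0 → ℕ}
    {y : ℝ≥0 → ℝ} (h : IsBufferPath π D n m y) {d : ℝ≥0} (hd : 0 < d) {k : ℕ} {t : ℝ≥0}
    (ht : t ≤ k * d) (hy : y t ≤ 0) : ∃ j ≤ k, y (j * d) ≤ d := by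
  refine ⟨⌊t / d⌋₊, ?_, ?_⟩
  · refine Nat.floor_le_of_le ?_
    exact (div_le_iff₀ hd).2 ht
  · have h1 : (⌊t / d⌋₊ : ℝ≥0) * d ≤ t := (le_div_iff₀ hd).1 (Nat.floor_le (by positivity))
    have h2 : t < (⌊t / d⌋₊ + 1 : ℝ≥0) * d := (div_lt_iff₀ hd).1 (Nat.lt_floor_add_one _)
    have h3 := h.sub_le h1
    have h4 : (t : ℝ) < (⌊t / d⌋₊ + 1) * d := by exact_mod_cast h2
    push_cast at h3
    linarith

lemma measureReal_exists_le_zero_le [IsProbabilityMeasure μ] (hV : IsBarrier α₀ α₁ T V S a b K δ)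
    (hN : IsPoissonPair μ ℱ R₀ Rc N Nc) (hx : IsBufferProcess μ ℱ N Nc (riskyPolicy T) D x)
    (hα₀ : 0 ≤ α₀) (hroot₀ : α₀ + (R₀ : ℝ) * (Real.exp (-α₀) - 1) = 0)
    (hα₁ : 0 ≤ α₁) (hroot₁ : α₁ + ((R₀ + Rc : ℝ≥0) : ℝ) * (Real.exp (-α₁) - 1) = 0)
    {L : ℕ} (hL : 0 < L) : μ.real {ω | ∃ t : ℝ≥0, t ≤ L ∧ x t ω ≤ 0} ≤ V D := by
  set p := μ.real {ω | ∃ t : ℝ≥0, t ≤ L ∧ x t ω ≤ 0} with hp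
  set R : ℝ := ((R₀ + Rc : ℝ≥0) : ℝ) with hR
  -- Divide `[0, L]` into `n` steps: the total error is `n (R L / n)² = (R L)² / n`.
  have hbound : ∀ᶠ n : ℕ in atTop,
      V ((L : ℝ) / n) * p ≤ V D + (R * L) ^ 2 / n := by
    have hlim : Tendsto (fun n : ℕ => (L : ℝ) / n) atTop (𝓝 0) :=
      tendsto_const_div_atTop_nhds_zero_nat _
    filter_upwards [hlim.eventually (ge_mem_nhds hV.delta_pos), eventually_gt_atTop 0]
      with n hn hn0
    set d : ℝ≥0 := (L : ℝ≥0) / n with hd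
    have hdc : (d : ℝ) = (L : ℝ) / n := by simp [hd]
    have hn0' : (0 : ℝ) < n := Nat.cast_pos.2 hn0
    have hd0 : 0 < d := by
      rw [hd]
      exact div_pos (Nat.cast_pos.2 hL) (Nat.cast_pos.2 hn0)
    have hnd : (n : ℝ≥0) * d = L := by
      rw [hd]
      field_simp
    have h1 := hV.gridSurvival_bound hN hx hα₀ hroot₀ hα₁ hroot₁ (d := d) (by rwa [hdc]) n
    have h2 : 0 ≤ ∫ ω in gridSurvival x d n, V (x (n * d) ω) ∂μ :=
      integral_nonneg fun ω => hV.nonneg _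
    have h3 : p ≤ μ.real (gridSurvival x d n)ᶜ := by
      refine ENNReal.toReal_mono (measure_ne_top _ _) (measure_mono_ae ?_)
      filter_upwards [ae_isBufferPath hN hx] with ω hpath hω hs
      obtain ⟨t, htL, hxt⟩ := hω
      obtain ⟨j, hj, hxj⟩ := hpath.exists_grid_le hd0 (k := n) (by rwa [hnd]) hxt
      exact absurd (hs j hj) (not_lt.2 hxj)
    have h4 := mul_le_mul_of_nonneg_left h3 (hV.nonneg d)
    have h5 : (n : ℝ) * (R * d) ^ 2 = (R * L) ^ 2 / n := by
      rw [hdc]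
      field_simp
    rw [← hdc]
    linarith
  have hlim : Tendsto (fun n : ℕ => (L : ℝ) / n) atTop (𝓝[≥] 0) :=
    tendsto_nhdsWithin_iff.2 ⟨tendsto_const_div_atTop_nhds_zero_nat _,
      .of_forall fun n => mem_Ici.2 (by positivity)⟩
  have hl := (hV.tendsto_zero.comp hlim).mul_const p
  have hr := (tendsto_const_div_atTop_nhds_zero_nat ((R * L) ^ 2)).const_add (V D)
  rw [one_mul] at hl
  rw [add_zero] at hr
  exact le_of_tendsto_of_tendsto hl hr hbound

lemma _root_.Streaming.interruption_subset (x : ℝ≥0 → Ω → ℝ) :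
    {ω | tauE x ω < tauF ⊤ x ω} ⊆ ⋃ L : ℕ, {ω | ∃ t : ℝ≥0, t ≤ L ∧ x t ω ≤ 0} := by
  intro ω hω
  have h1 : tauE x ω < ⊤ := lt_of_lt_of_le hω le_top
  simp only [tauE, iInf_lt_iff] at h1
  obtain ⟨t, ht, -⟩ := h1
  obtain ⟨L, hL⟩ := exists_nat_ge t
  exact mem_iUnion.2 ⟨L, t, hL, ht⟩

/-- A barrier bounds the interruption probability for an infinite file. -/
theorem interruptionProb_le [IsProbabilityMeasure μ] (hV : IsBarrier α₀ α₁ T V S a b K δ)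
    (hN : IsPoissonPair μ ℱ R₀ Rc N Nc) (hx : IsBufferProcess μ ℱ N Nc (riskyPolicy T) D x)
    (hα₀ : 0 ≤ α₀) (hroot₀ : α₀ + (R₀ : ℝ) * (Real.exp (-α₀) - 1) = 0)
    (hα₁ : 0 ≤ α₁) (hroot₁ : α₁ + ((R₀ + Rc : ℝ≥0) : ℝ) * (Real.exp (-α₁) - 1) = 0) :
    interruptionProb μ ⊤ x ≤ V D := by
  set E : ℕ → Set Ω := fun L => {ω | ∃ t : ℝ≥0, t ≤ L ∧ x t ω ≤ 0} with hE
  have hmono : Monotone E := by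
    rintro L L' hLL ω ⟨t, ht, hxt⟩
    exact ⟨t, ht.trans (Nat.cast_le.2 hLL), hxt⟩
  have hfin : ∀ L, μ (E L) ≤ ENNReal.ofReal (V D) := by
    intro L
    have h1 := hV.measureReal_exists_le_zero_le hN hx hα₀ hroot₀ hα₁ hroot₁ L.succ_pos
    refine (measure_mono (hmono L.le_succ)).trans ?_
    exact (ENNReal.le_ofReal_iff_toReal_le (measure_ne_top _ _) (hV.nonneg _)).2 h1
  refine ENNReal.toReal_le_of_le_ofReal (hV.nonneg _) ?_
  refine (measure_mono (interruption_subset x)).trans ?_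
  change μ (⋃ L, E L) ≤ _
  rw [hmono.measure_iUnion]
  exact iSup_le hfin

end IsBarrier

end Streaming

/-! ### The roots `α₀`, `α₁` and the explicit barriers. -/

namespace Streaming

open Set Filter Topology Function

lemma bddAbove_rBar_set {R : ℝ} (hR : 0 < R) :
    BddAbove {r : ℝ | r + R * (Real.exp (-r) - 1) = 0} := by
  refine ⟨R, fun r hr => ?_⟩
  have hr' : r + R * (Real.exp (-r) - 1) = 0 := hr
  nlinarith [mul_pos hR (Real.exp_pos (-r))]

/-- The function is nonnegative from `R` on, so the intermediate value theorem gives a root to the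
right of `r`. Positivity and monotonicity of `rBar` follow by testing suitable points. -/
lemma le_rBar {R r : ℝ} (hR : 0 < R) (hr : r + R * (Real.exp (-r) - 1) ≤ 0) : r ≤ rBar R := by
  have hc : ContinuousOn (fun r : ℝ => r + R * (Real.exp (-r) - 1)) (Icc r (max r R)) := by
    fun_prop
  have h1 : 0 ≤ max r R + R * (Real.exp (-(max r R)) - 1) := by
    nlinarith [mul_pos hR (Real.exp_pos (-(max r R))), le_max_right r R]
  obtain ⟨r', hr', h0⟩ := intermediate_value_Icc (le_max_left r R) hc ⟨hr, h1⟩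
  exact hr'.1.trans (le_csSup (bddAbove_rBar_set hR) h0)

lemma rBar_root {R : ℝ} (hR : 0 < R) : rBar R + R * (Real.exp (-rBar R) - 1) = 0 := by
  have hcl : IsClosed {r : ℝ | r + R * (Real.exp (-r) - 1) = 0} :=
    isClosed_eq (by fun_prop) (by fun_prop)
  exact hcl.csSup_mem ⟨0, by simp⟩ (bddAbove_rBar_set hR)

lemma rBar_pos {R : ℝ} (hR : 1 < R) : 0 < rBar R := by
  -- Test point `R - 1`: there the condition reads `R e^{-(R-1)} ≤ 1`, that is, `R ≤ e^{R-1}`.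
  refine (sub_pos.2 hR).trans_le (le_rBar (by linarith) ?_)
  have h1 : R * Real.exp (-(R - 1)) ≤ 1 := by
    have h2 := Real.add_one_le_exp (R - 1)
    have h3 := Real.exp_pos (-(R - 1))
    have h4 : Real.exp (-(R - 1)) * Real.exp (R - 1) = 1 := by
      rw [← Real.exp_add]
      simp
    nlinarith
  linarith

lemma rBar_lt_rBar {R R' : ℝ} (hR : 1 < R) (hRR : R < R') : rBar R < rBar R' := by
  have hlt : rBar R + R' * (Real.exp (-rBar R) - 1) < 0 := by
    have h1 := rBar_root (R := R) (by linarith)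
    have h2 : Real.exp (-rBar R) < 1 := Real.exp_lt_one_iff.2 (neg_lt_zero.2 (rBar_pos hR))
    nlinarith
  refine lt_of_le_of_ne (le_rBar (by linarith) hlt.le) fun he => ?_
  rw [he, rBar_root (by linarith)] at hlt
  exact lt_irrefl _ hlt

/-- The interruption probability under the free server alone, capped at `1`, is a barrier for
every threshold. -/
lemma isBarrier_exp {α₀ : ℝ} (hα₀ : 0 ≤ α₀) (α₁ T : ℝ) :
    IsBarrier α₀ α₁ T (fun y => min 1 (Real.exp (-(α₀ * y)))) 0 0 1 1 1 where
  antitone y y' h := by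
    have : Real.exp (-(α₀ * y')) ≤ Real.exp (-(α₀ * y)) := by gcongr
    exact min_le_min_left 1 this
  nonneg y := le_min zero_le_one (Real.exp_nonneg _)
  le_one y := min_le_left _ _
  tendsto_zero := by
    have hc : Continuous fun y : ℝ => min 1 (Real.exp (-(α₀ * y))) := by fun_prop
    have := hc.tendsto 0
    simp only [mul_zero, neg_zero, Real.exp_zero, min_self] at this
    exact this.mono_left nhdsWithin_le_nhds
  lt_threshold y h0 h1 := absurd h0 (not_lt.2 h1.le)
  a_nonneg := le_rfl
  b_nonneg := zero_le_one
  delta_pos := one_pos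
  eq_low y h0 h1 := absurd h0 (not_lt.2 h1.le)
  le_low y _ := by simp
  eq_high y h0 _ := by
    rw [one_mul, min_eq_right]
    exact Real.exp_le_one_iff.2 (neg_nonpos.2 (mul_nonneg hα₀ h0.le))
  le_high y _ _ := by
    rw [one_mul]
    exact min_le_right _ _

/-- The barrier below the threshold: `1` at `0` and `β e^{-α₁ T}` at `T`. -/
noncomputable def lowBarrier (α₁ β T y : ℝ) : ℝ :=
  (1 - β * Real.exp (-(α₁ * T))) / (1 - Real.exp (-(α₁ * T))) * Real.exp (-(α₁ * y)) +
    Real.exp (-(α₁ * T)) * (β - 1) / (1 - Real.exp (-(α₁ * T)))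

/-- The barrier above the threshold: `β e^{-α₁ T - α₀ (y - T)}`. -/
noncomputable def highBarrier (α₀ α₁ β T y : ℝ) : ℝ :=
  β * Real.exp (-(α₁ * T)) * Real.exp (α₀ * T) * Real.exp (-(α₀ * y))

open Classical in
/-- The barrier bounding the interruption probability of the risky policy. -/
noncomputable def riskyBarrier (α₀ α₁ β T y : ℝ) : ℝ :=
  min 1 (if y < T then lowBarrier α₁ β T y else highBarrier α₀ α₁ β T y)

/-! ### Comparison of the two branches at the threshold. -/

section Barrier

variable {α₀ α₁ β T : ℝ}

lemma exp_threshold_lt_one (hα₁ : 0 < α₁) (hT : 0 < T) : Real.exp (-(α₁ * T)) < 1 :=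
  Real.exp_lt_one_iff.2 (neg_lt_zero.2 (mul_pos hα₁ hT))

lemma lowBarrier_antitone (hα₁ : 0 < α₁) (hT : 0 < T) (hβT : β * Real.exp (-(α₁ * T)) < 1) :
    Antitone (lowBarrier α₁ β T) := by
  intro y y' h
  have h1 : 0 ≤ (1 - β * Real.exp (-(α₁ * T))) / (1 - Real.exp (-(α₁ * T))) :=
    div_nonneg (by linarith) (by linarith [exp_threshold_lt_one hα₁ hT])
  unfold lowBarrier
  gcongr

lemma lowBarrier_zero (hα₁ : 0 < α₁) (hT : 0 < T) : lowBarrier α₁ β T 0 = 1 := by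
  have h1 : 1 - Real.exp (-(α₁ * T)) ≠ 0 := by linarith [exp_threshold_lt_one hα₁ hT]
  rw [lowBarrier, mul_zero, neg_zero, Real.exp_zero]
  field_simp
  ring

/-- The difference of the two barriers at distance `s` from the threshold. -/
lemma lowBarrier_sub_highBarrier (hα₁ : 0 < α₁) (hT : 0 < T) (s : ℝ) :
    lowBarrier α₁ β T (T + s) - highBarrier α₀ α₁ β T (T + s) =
      Real.exp (-(α₁ * T)) / (1 - Real.exp (-(α₁ * T))) *
        (β * (1 - Real.exp (-(α₁ * T))) * (1 - Real.exp (-(α₀ * s))) -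
          (1 - β * Real.exp (-(α₁ * T))) * (1 - Real.exp (-(α₁ * s)))) := by
  have h1 : 1 - Real.exp (-(α₁ * T)) ≠ 0 := by linarith [exp_threshold_lt_one hα₁ hT]
  have h2 : Real.exp (-(α₁ * (T + s))) = Real.exp (-(α₁ * T)) * Real.exp (-(α₁ * s)) := by
    rw [← Real.exp_add]
    ring_nf
  have h3 : Real.exp (α₀ * T) * Real.exp (-(α₀ * (T + s))) = Real.exp (-(α₀ * s)) := by
    rw [← Real.exp_add]
    ring_nf
  rw [lowBarrier, highBarrier, mul_assoc _ (Real.exp (α₀ * T)), h3, h2]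
  field_simp
  ring

lemma highBarrier_le_lowBarrier (hα₀ : 0 < α₀) (hα : α₀ < α₁) (hβ : 1 < β)
    (hβα : α₁ ≤ β * α₀) (hT : 0 < T) {y : ℝ} (hy : T ≤ y) :
    highBarrier α₀ α₁ β T y ≤ lowBarrier α₁ β T y := by
  have hα₁ : 0 < α₁ := hα₀.trans hα
  obtain ⟨s, rfl⟩ : ∃ s, y = T + s := ⟨y - T, by ring⟩
  have hs : 0 ≤ s := by linarith
  rw [← sub_nonneg, lowBarrier_sub_highBarrier hα₁ hT]
  have hz := exp_threshold_lt_one hα₁ hT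
  have hz0 := Real.exp_pos (-(α₁ * T))
  set z := Real.exp (-(α₁ * T))
  refine mul_nonneg (div_nonneg hz0.le (by linarith)) ?_
  have hw0 : Real.exp (-(α₀ * s)) ≤ 1 := Real.exp_le_one_iff.2 (neg_nonpos.2 (by positivity))
  have hwv : Real.exp (-(α₁ * s)) ≤ Real.exp (-(α₀ * s)) := by gcongr
  -- Bernoulli's inequality for `e^{-α₁ s} = (e^{-α₀ s})^{α₁/α₀}`.
  have hbern : 1 + α₁ / α₀ * (Real.exp (-(α₀ * s)) - 1) ≤ Real.exp (-(α₁ * s)) := by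
    have h1 := one_add_mul_self_le_rpow_one_add (s := Real.exp (-(α₀ * s)) - 1)
      (by linarith [Real.exp_pos (-(α₀ * s))]) ((one_le_div hα₀).2 hα.le)
    rw [add_sub_cancel, ← Real.exp_mul] at h1
    refine h1.trans_eq ?_
    congr 1
    field_simp
  have hp : α₁ / α₀ ≤ β := (div_le_iff₀ hα₀).2 hβα
  have h2 : 1 - Real.exp (-(α₁ * s)) ≤ β * (1 - Real.exp (-(α₀ * s))) := by nlinarith
  have h3 : 0 ≤ β * z * (Real.exp (-(α₀ * s)) - Real.exp (-(α₁ * s))) :=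
    mul_nonneg (by positivity) (by linarith)
  nlinarith

/-- At `T` the low branch is strictly less steep than the high one, since `β > 1` makes `α₁ (1 - β
z) / (1 - z) < α₁ ≤ β α₀`. The width of the interval is chosen so that the quadratic remainder of
`e^{α₁ u}` fits into this slack; the `min` with `1` keeps `α₁ u` where that remainder bound is
valid. -/
lemma lowBarrier_le_highBarrier (hα₀ : 0 < α₀) (hα : α₀ < α₁) (hβ : 1 < β)
    (hβα : α₁ ≤ β * α₀) (hT : 0 < T) (hβT : β * Real.exp (-(α₁ * T)) < 1) {y : ℝ}
    (hy : T - min 1 ((β - 1) * Real.exp (-(α₁ * T))) / α₁ ≤ y) (hyT : y ≤ T) :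
    lowBarrier α₁ β T y ≤ highBarrier α₀ α₁ β T y := by
  have hα₁ : 0 < α₁ := hα₀.trans hα
  obtain ⟨u, rfl⟩ : ∃ u, y = T + -u := ⟨T - y, by ring⟩
  have hu : 0 ≤ u := by linarith
  rw [← sub_nonpos, lowBarrier_sub_highBarrier hα₁ hT]
  have hz := exp_threshold_lt_one hα₁ hT
  have hz0 := Real.exp_pos (-(α₁ * T))
  set z := Real.exp (-(α₁ * T))
  refine mul_nonpos_of_nonneg_of_nonpos (div_nonneg hz0.le (by linarith)) ?_
  have hu1 : u ≤ min 1 ((β - 1) * z) / α₁ := by linarith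
  rw [le_div_iff₀ hα₁, le_min_iff] at hu1
  rw [mul_neg, neg_neg, mul_neg, neg_neg]
  have h0 : α₀ * u + 1 ≤ Real.exp (α₀ * u) := Real.add_one_le_exp _
  have hw : 0 ≤ α₁ * u := by positivity
  have h1 : Real.exp (α₁ * u) - 1 ≤ α₁ * u * (1 + (β - 1) * z) := by
    have h2 := Real.abs_exp_sub_one_sub_id_le (x := α₁ * u)
      (by rw [abs_of_nonneg hw]; linarith [hu1.1])
    have h3 := (abs_le.1 h2).2
    nlinarith [hu1.2]
  -- The difference of the two sides is exactly `β (β - 1) z²`.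
  have h4 : (1 - β * z) * (1 + (β - 1) * z) ≤ 1 - z := by
    nlinarith [mul_pos (mul_pos (sub_pos.2 hβ) hz0) (mul_pos (zero_lt_one.trans hβ) hz0)]
  have h5 : (1 - β * z) * (Real.exp (α₁ * u) - 1) ≤ (1 - z) * (α₁ * u) := by
    calc (1 - β * z) * (Real.exp (α₁ * u) - 1)
        ≤ (1 - β * z) * (α₁ * u * (1 + (β - 1) * z)) :=
          mul_le_mul_of_nonneg_left h1 (by linarith)
      _ = ((1 - β * z) * (1 + (β - 1) * z)) * (α₁ * u) := by ring
      _ ≤ (1 - z) * (α₁ * u) := mul_le_mul_of_nonneg_right h4 hw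
  have h6 : α₁ * u ≤ β * (Real.exp (α₀ * u) - 1) := by nlinarith
  have h7 : (1 - z) * (α₁ * u) ≤ (1 - z) * (β * (Real.exp (α₀ * u) - 1)) :=
    mul_le_mul_of_nonneg_left h6 (by linarith)
  linarith

lemma highBarrier_antitone (hα₀ : 0 ≤ α₀) (hβ : 0 ≤ β) :
    Antitone (highBarrier α₀ α₁ β T) := by
  intro y y' h
  unfold highBarrier
  gcongr

lemma highBarrier_threshold : highBarrier α₀ α₁ β T T = β * Real.exp (-(α₁ * T)) := by
  rw [highBarrier, mul_assoc _ (Real.exp (α₀ * T)), ← Real.exp_add, add_neg_cancel,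
    Real.exp_zero, mul_one]

lemma isBarrier_risky (hα₀ : 0 < α₀) (hα : α₀ < α₁) (hβ : 1 < β) (hβα : α₁ ≤ β * α₀)
    (hT : 0 < T) (hβT : β * Real.exp (-(α₁ * T)) < 1) :
    IsBarrier α₀ α₁ T (riskyBarrier α₀ α₁ β T) T
      ((1 - β * Real.exp (-(α₁ * T))) / (1 - Real.exp (-(α₁ * T))))
      (Real.exp (-(α₁ * T)) * (β - 1) / (1 - Real.exp (-(α₁ * T))))
      (β * Real.exp (-(α₁ * T)) * Real.exp (α₀ * T))
      (min 1 ((β - 1) * Real.exp (-(α₁ * T))) / α₁) := by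
  have hα₁ : 0 < α₁ := hα₀.trans hα
  have hz := exp_threshold_lt_one hα₁ hT
  have hz0 := Real.exp_pos (-(α₁ * T))
  have hLanti := lowBarrier_antitone hα₁ hT hβT
  have hHanti := highBarrier_antitone (α₁ := α₁) (T := T) hα₀.le (zero_le_one.trans hβ.le)
  have hle := fun {y} => highBarrier_le_lowBarrier hα₀ hα hβ hβα hT (y := y)
  have hδ : 0 < min 1 ((β - 1) * Real.exp (-(α₁ * T))) / α₁ :=
    div_pos (lt_min one_pos (mul_pos (sub_pos.2 hβ) hz0)) hα₁
  have ha : 0 ≤ (1 - β * Real.exp (-(α₁ * T))) / (1 - Real.exp (-(α₁ * T))) :=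
    div_nonneg (by linarith) (by linarith)
  have hb : 0 ≤ Real.exp (-(α₁ * T)) * (β - 1) / (1 - Real.exp (-(α₁ * T))) :=
    div_nonneg (mul_nonneg hz0.le (by linarith)) (by linarith)
  have hL0 : ∀ y, 0 ≤ lowBarrier α₁ β T y := fun y =>
    add_nonneg (mul_nonneg ha (Real.exp_nonneg _)) hb
  have hH0 : ∀ y, 0 ≤ highBarrier α₀ α₁ β T y := fun y => by
    unfold highBarrier
    positivity
  have hpw : ∀ y, riskyBarrier α₀ α₁ β T y ≤ lowBarrier α₁ β T y := fun y => by
    refine (min_le_right _ _).trans ?_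
    split_ifs with h
    · exact le_rfl
    · exact hle (not_lt.1 h)
  refine ⟨fun y y' h => min_le_min_left 1 ?_, fun y => le_min zero_le_one ?_,
    fun y => min_le_left _ _, ?_, fun _ _ h => h, ha, hb, hδ, fun y h0 h1 => ?_,
    fun y _ => hpw y, fun y h0 h1 => ?_, fun y h0 h1 => ?_⟩
  · split_ifs with h1 h2 h2
    · exact hLanti h
    · exact absurd (h.trans_lt h1) h2
    · have h3 : highBarrier α₀ α₁ β T T = lowBarrier α₁ β T T :=
        le_antisymm (hle le_rfl)
          (lowBarrier_le_highBarrier hα₀ hα hβ hβα hT hβT (by linarith) le_rfl)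
      exact (hHanti (not_lt.1 h1)).trans (h3.trans_le (hLanti h2.le))
    · exact hHanti h
  · split_ifs
    · exact hL0 y
    · exact hH0 y
  · have hc : Continuous fun y : ℝ => min 1 (lowBarrier α₁ β T y) := by
      unfold lowBarrier
      fun_prop
    have h1 := hc.tendsto 0
    rw [lowBarrier_zero hα₁ hT, min_self] at h1
    refine (h1.congr' ?_).mono_left nhdsWithin_le_nhds
    filter_upwards [Iio_mem_nhds hT] with y hy
    rw [riskyBarrier, if_pos (mem_Iio.1 hy)]
  · rw [riskyBarrier, if_pos h1, min_eq_right]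
    · rfl
    · exact (hLanti h0.le).trans_eq (lowBarrier_zero hα₁ hT)
  · rw [riskyBarrier, if_neg (not_lt.2 h1), min_eq_right]
    · rfl
    · exact (hHanti h1).trans (highBarrier_threshold.trans_le hβT.le)
  · refine (min_le_right _ _).trans ?_
    split_ifs with h
    · exact lowBarrier_le_highBarrier hα₀ hα hβ hβα hT hβT h1 h.le
    · exact le_rfl

end Barrier

end Streaming

/-! ### What the condition `T* ≤ T` gives at the initial buffer size. -/

namespace Streaming

open Set Filter Topology Function

section Threshold

variable {α₀ α₁ D ε T : ℝ}

lemma exp_neg_le_of_mem_region (hα₁ : 0 < α₁) (hε : 0 < ε) (h : (D, ε) ∈ region α₀ α₁) :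
    Real.exp (-(α₁ * D)) ≤ ε := by
  have h1 : 1 / α₁ * Real.log (1 / ε) ≤ D := h.1
  rw [one_div, one_div, Real.log_inv, inv_mul_eq_div, div_le_iff₀ hα₁] at h1
  calc Real.exp (-(α₁ * D)) ≤ Real.exp (Real.log ε) := Real.exp_le_exp.2 (by linarith)
    _ = ε := Real.exp_log hε

lemma pos_of_mem_region (hα₁ : 0 < α₁) (hε : 0 < ε) (hε1 : ε < 1)
    (h : (D, ε) ∈ region α₀ α₁) : 0 < D := by
  have h1 := (exp_neg_le_of_mem_region hα₁ hε h).trans_lt hε1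
  rw [Real.exp_lt_one_iff] at h1
  nlinarith

/-- What the lower bound `T* ≤ T` says in each of the two cases, without logarithms. -/
lemma threshold_cases (hα₀ : 0 < α₀) (hα : α₀ < α₁) (hβ : 1 < betaConst α₀ α₁) (hε : 0 < ε)
    (hε1 : ε < 1) (hD : (D, ε) ∈ region α₀ α₁) (hT : thresholdStar α₀ α₁ D ε ≤ (T : EReal)) :
    (betaConst α₀ α₁ * Real.exp (-(α₁ * D)) ≤ ε ∧
      highBarrier α₀ α₁ (betaConst α₀ α₁) T D ≤ ε) ∨
    Real.exp (-(α₁ * T)) * (ε + betaConst α₀ α₁ * (1 - Real.exp (-(α₁ * D))) - 1) ≤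
      ε - Real.exp (-(α₁ * D)) := by
  have hα₁ : 0 < α₁ := hα₀.trans hα
  have hβ0 : 0 < betaConst α₀ α₁ := zero_lt_one.trans hβ
  have hq := exp_neg_le_of_mem_region hα₁ hε hD
  have hDpos := pos_of_mem_region hα₁ hε hε1 hD
  have hq1 : Real.exp (-(α₁ * D)) < 1 := exp_threshold_lt_one hα₁ hDpos
  have hlog : ∀ {w : ℝ}, Real.log (betaConst α₀ α₁ / ε) ≤ w →
      betaConst α₀ α₁ * Real.exp (-w) ≤ ε := fun {w} hw => by
    have h1 := (Real.log_le_iff_le_exp (div_pos hβ0 hε)).1 hw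
    rw [div_le_iff₀ hε] at h1
    rw [Real.exp_neg, ← div_eq_mul_inv, div_le_iff₀ (Real.exp_pos _)]
    linarith
  unfold thresholdStar at hT
  split_ifs at hT with h1 h2
  · left
    rw [DBar, one_div, inv_mul_eq_div, div_le_iff₀ hα₁] at h1
    rw [EReal.coe_le_coe_iff, one_div, inv_mul_eq_div, div_le_iff₀ (sub_pos.2 hα)] at hT
    refine ⟨hlog (by linarith), ?_⟩
    have h3 := hlog (w := α₁ * T - α₀ * T + α₀ * D) (by linarith)
    rw [highBarrier, mul_assoc, mul_assoc, ← Real.exp_add, ← Real.exp_add]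
    convert h3 using 3
    ring
  · exact absurd hT (not_le.2 (EReal.coe_lt_top T))
  · right
    have hεq : 0 < ε - Real.exp (-(α₁ * D)) :=
      lt_of_le_of_ne (by linarith) (Ne.symm h2)
    have hnum : 0 < ε + betaConst α₀ α₁ * (1 - Real.exp (-(α₁ * D))) - 1 := by nlinarith
    rw [EReal.coe_le_coe_iff, one_div, inv_mul_eq_div, div_le_iff₀ hα₁,
      Real.log_le_iff_le_exp (div_pos hnum hεq), div_le_iff₀ hεq] at hT
    rw [Real.exp_neg, inv_mul_eq_div, div_le_iff₀ (Real.exp_pos _), mul_comm α₁ T]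
    linarith

end Threshold

/-- If `β e^{-α₁ T} ≥ 1`, the free server alone meets the requirement. -/
lemma exp_neg_le_of_one_le {α₀ α₁ D ε T : ℝ} (hα₀ : 0 < α₀) (hα : α₀ < α₁)
    (hβ : 1 < betaConst α₀ α₁) (hε : 0 < ε) (hε1 : ε < 1) (hD : (D, ε) ∈ region α₀ α₁)
    (hT : thresholdStar α₀ α₁ D ε ≤ (T : EReal))
    (hβT : 1 ≤ betaConst α₀ α₁ * Real.exp (-(α₁ * T))) : Real.exp (-(α₀ * D)) ≤ ε := by
  have hα₁ : 0 < α₁ := hα₀.trans hα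
  have hq1 := exp_threshold_lt_one hα₁ (pos_of_mem_region hα₁ hε hε1 hD)
  rcases threshold_cases hα₀ hα hβ hε hε1 hD hT with ⟨-, h⟩ | h
  · refine le_trans ?_ h
    rw [highBarrier]
    refine le_mul_of_one_le_left (Real.exp_nonneg _) ?_
    rcases le_total 0 T with h0 | h0
    · have : 1 ≤ Real.exp (α₀ * T) := Real.one_le_exp (by positivity)
      nlinarith
    · have : 1 ≤ Real.exp (-(α₁ * T)) * Real.exp (α₀ * T) := by
        rw [← Real.exp_add]
        exact Real.one_le_exp (by nlinarith)
      rw [mul_assoc]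
      nlinarith
  -- In the second case, `β z ≥ 1` would force `z ≥ 1`; then the left side of `h` exceeds `ε - q`,
  -- because `β > 1`.
  · exfalso
    set q := Real.exp (-(α₁ * D))
    set z := Real.exp (-(α₁ * T))
    have hz : 1 ≤ z := by
      have h1 : 1 * (1 - q) ≤ betaConst α₀ α₁ * z * (1 - q) :=
        mul_le_mul_of_nonneg_right hβT (by linarith)
      have h2 : 0 ≤ (z - 1) * (1 - ε) := by linarith
      nlinarith
    have h3 : ε - q < ε + betaConst α₀ α₁ * (1 - q) - 1 := by nlinarith
    have h4 := exp_neg_le_of_mem_region hα₁ hε hD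
    nlinarith

/-- Above the threshold `T*`, the barrier at the initial buffer size is at most `ε`. -/
lemma riskyBarrier_le {α₀ α₁ D ε T : ℝ} (hα₀ : 0 < α₀) (hα : α₀ < α₁)
    (hβ : 1 < betaConst α₀ α₁) (hβα : α₁ ≤ betaConst α₀ α₁ * α₀) (hε : 0 < ε) (hε1 : ε < 1)
    (hD : (D, ε) ∈ region α₀ α₁) (hT : thresholdStar α₀ α₁ D ε ≤ (T : EReal)) (hT0 : 0 < T)
    (hβT : betaConst α₀ α₁ * Real.exp (-(α₁ * T)) < 1) :
    riskyBarrier α₀ α₁ (betaConst α₀ α₁) T D ≤ ε := by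
  have hα₁ : 0 < α₁ := hα₀.trans hα
  have hDpos := pos_of_mem_region hα₁ hε hε1 hD
  have hz := exp_threshold_lt_one hα₁ hT0
  have hlow : ∀ {w : ℝ}, (Real.exp (-(α₁ * D)) - Real.exp (-(α₁ * T))) +
      betaConst α₀ α₁ * Real.exp (-(α₁ * T)) * (1 - Real.exp (-(α₁ * D))) ≤
        w * (1 - Real.exp (-(α₁ * T))) →
      riskyBarrier α₀ α₁ (betaConst α₀ α₁) T D ≤ w := fun {w} hw => by
    refine ((isBarrier_risky hα₀ hα hβ hβα hT0 hβT).le_low D hDpos).trans ?_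
    rw [div_mul_eq_mul_div, ← add_div, div_le_iff₀ (by linarith)]
    linarith
  rcases threshold_cases hα₀ hα hβ hε hε1 hD hT with ⟨h1, h2⟩ | h
  · rcases le_or_gt T D with hTD | hTD
    · refine le_trans (min_le_right _ _) ?_
      rwa [if_neg (not_lt.2 hTD)]
    · refine le_trans (hlow ?_) h1
      have h3 : Real.exp (-(α₁ * T)) ≤ Real.exp (-(α₁ * D)) := by gcongr
      -- With `q = e^{-α₁ D}` and `z = e^{-α₁ T}`, the slack is `(β - 1) (q - z)`.
      nlinarith
  -- The low branch dominates the barrier on both sides of `T`, so `D` and `T` need not be compared.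
  · refine hlow ?_
    linarith

end Streaming

/-! ### Assembly of the theorem. -/

theorem mainTheorem2
    {Ω : Type*} {mΩ : MeasurableSpace Ω} (μ : Measure Ω) [IsProbabilityMeasure μ]
    (ℱ : Filtration ℝ≥0 mΩ)
    (R₀ Rc : ℝ≥0) (hR₀ : 1 < R₀) (hRc : 0 < Rc)
    (N Nc : ℝ≥0 → Ω → ℕ) (hN : Streaming.IsPoissonPair μ ℱ R₀ Rc N Nc)
    (R₁ α₀ α₁ : ℝ) (hR₁ : R₁ = (R₀ : ℝ) + (Rc : ℝ))
    (hα₀ : α₀ = Streaming.rBar (R₀ : ℝ)) (hα₁ : α₁ = Streaming.rBar R₁)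
    (hα₀_lt : α₀ < 2)
    (D ε : ℝ) (hε : 0 < ε) (hDε : (D, ε) ∈ Streaming.region α₀ α₁)
    (T : ℝ) (hT : Streaming.thresholdStar α₀ α₁ D ε ≤ (T : EReal))
    (x : ℝ≥0 → Ω → ℝ)
    (hx : Streaming.IsBufferProcess μ ℱ N Nc (Streaming.riskyPolicy T) D x) :
    Streaming.IsFeasible μ x ε := by
  have hR₀' : (1 : ℝ) < R₀ := by exact_mod_cast hR₀
  have hRc' : (0 : ℝ) < Rc := by exact_mod_cast hRc
  have hRR : (R₀ : ℝ) < R₁ := by linarith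
  have hpos₀ : 0 < α₀ := hα₀ ▸ Streaming.rBar_pos hR₀'
  have hlt : α₀ < α₁ := by
    rw [hα₀, hα₁]
    exact Streaming.rBar_lt_rBar hR₀' hRR
  have hpos₁ : 0 < α₁ := hpos₀.trans hlt
  have hroot₀ : α₀ + (R₀ : ℝ) * (Real.exp (-α₀) - 1) = 0 :=
    hα₀ ▸ Streaming.rBar_root (by linarith)
  have hroot₁ : α₁ + ((R₀ + Rc : ℝ≥0) : ℝ) * (Real.exp (-α₁) - 1) = 0 := by
    rw [NNReal.coe_add, ← hR₁, hα₁]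
    exact Streaming.rBar_root (by linarith)
  have hden : 0 < 1 - α₀ / 2 := by linarith
  -- Apart from this bound and its consequence `β > 1`, the precise value of `β` is irrelevant.
  have hβα : α₁ ≤ Streaming.betaConst α₀ α₁ * α₀ := by
    have h1 : Streaming.betaConst α₀ α₁ * α₀ = α₁ / (1 - α₀ / 2) := by
      rw [Streaming.betaConst]
      field_simp
    rw [h1, le_div_iff₀ hden]
    nlinarith
  have hβ : 1 < Streaming.betaConst α₀ α₁ := by
    by_contra! h
    nlinarith
  rcases le_or_gt 1 ε with hε1 | hε1
  · exact measureReal_le_one.trans hε1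
  rcases le_or_gt 1 (Streaming.betaConst α₀ α₁ * Real.exp (-(α₁ * T))) with hβT | hβT
  · have h1 := (Streaming.isBarrier_exp hpos₀.le α₁ T).interruptionProb_le hN hx hpos₀.le hroot₀
      hpos₁.le hroot₁
    exact (h1.trans (min_le_right _ _)).trans
      (Streaming.exp_neg_le_of_one_le hpos₀ hlt hβ hε hε1 hDε hT hβT)
  · have hT0 : 0 < T := by
      by_contra! h
      have h1 : 1 ≤ Real.exp (-(α₁ * T)) := Real.one_le_exp (by nlinarith)
      nlinarith
    have h1 := (Streaming.isBarrier_risky hpos₀ hlt hβ hβα hT0 hβT).interruptionProb_le hN hx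
      hpos₀.le hroot₀ hpos₁.le hroot₁
    exact h1.trans (Streaming.riskyBarrier_le hpos₀ hlt hβ hβα hε hε1 hDε hT hT0 hβT)
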